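/- Let $\Gamma$ be a finite abstract simplicial complex with vertex set $V$ (every element of $V$ is a vertex of $\Gamma$), and let $s$ be a positive integer. The dimension of a face $X$ is $|X|-1$, and the dimension of a complex is the maximum of the dimensions of its faces (so it is $-1$ for the complex without vertices). The $s$-chromatic polynomial $\chi_s(\Gamma;t)$ is the unique polynomial in $t$ whose value at each positive integer $t$ is the number of maps $f:V\to\{1,\dots,t\}$ such that every face of $\Gamma$ contains at most $s$ vertices of any given color. Let $\Gamma^{(1)}$ be the 1-skeleton of $\Gamma$, viewed as a simple graph on $V$. A flat of $\Gamma^{(1)}$ is a set $F$ of edges of $\Gamma^{(1)}$ such that every connected component of the graph $(V,F)$ is an induced subgraph of $\Gamma^{(1)}$; write $\mathcal F(\Gamma^{(1)})$ for the set of flats. For a flat $F$, let $c(F)$ be the number of connected components of $(V,F)$, let $\Gamma^{(1)}/F$ be the graph obtained from $\Gamma^{(1)}$ by contracting the edges in $F$, and let $\Gamma_{V,F}$ be the subcomplex of $\Gamma$ with vertex set $V$ whose faces are the faces of $\Gamma$ all of whose edges lie in $F$. Let $a(G)$ denote the number of acyclic orientations of a graph $G$. Then $$\chi_s(\Gamma;-1)=\sum_{\substack{F\in\mathcal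 F(\Gamma^{(1)})\\ \dim\Gamma_{V,F}<s}}(-1)^{c(F)}\,a(\Gamma^{(1)}/F).$$ -/

import Mathlib

namespace SimpleGraph

/-- A flat of `G`: a set `F` of edges of `G` such that every connected component of the graph
`(V, F)` is an induced subgraph of `G`. -/
def IsFlat {V : Type*} (G : SimpleGraph V) (F : Set (Sym2 V)) : Prop :=
  F ⊆ G.edgeSet ∧
    ∀ C : (fromEdgeSet F).ConnectedComponent,
      (fromEdgeSet F).induce C.supp = G.induce C.supp

/-- The set of flats of a finite graph. -/
noncomputable def flats {V : Type*} [Finite V] (G : SimpleGraph V) : Finset (Set (Sym2 V)) :=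
  (Set.toFinite {F : Set (Sym2 V) | G.IsFlat F}).toFinset

/-- `c(F)`: the number of connected components of the graph `(V, F)`. -/
noncomputable def numComponents {V : Type*} (F : Set (Sym2 V)) : ℕ :=
  Nat.card (fromEdgeSet F).ConnectedComponent

/-- `G / F`: the vertices are the connected components of `(V, F)`, and two distinct ones are
adjacent if some edge of `G` joins them. (Parallel edges are merged: in an acyclic orientation
they all point the same way, so this does not affect the number of acyclic orientations. Loops do
not arise when `F` is a flat.) -/
def contractEdges {V : Type*} (G : SimpleGraph V) (F : Set (Sym2 V)) :
    SimpleGraph (fromEdgeSet F).ConnectedComponent :=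
  G.map (fromEdgeSet F).connectedComponentMk

/-- `D` is an orientation of `G`: each edge of `G` receives exactly one of its two directions,
and `D` has no other arcs. -/
def IsOrientation {V : Type*} (G : SimpleGraph V) (D : Digraph V) : Prop :=
  (∀ u v, D.Adj u v → G.Adj u v) ∧ ∀ u v, G.Adj u v → Xor (D.Adj u v) (D.Adj v u)

/-- `a(G)`: the number of orientations of `G` without directed cycles. -/
noncomputable def numAcyclicOrientations {V : Type*} (G : SimpleGraph V) : ℕ :=
  Nat.card {D : Digraph V // G.IsOrientation D ∧ ∀ v, ¬ Relation.TransGen D.Adj v v}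

end SimpleGraph

namespace AbstractSimplicialComplex

/-! A finite simplicial complex with vertex set `V` is an `AbstractSimplicialComplex V` with `V`
finite. (In Mathlib the empty face is left implicit and every `v : V` is a vertex.) -/

/-- The dimension of a finite complex: the largest number of vertices of a face, minus one. The
complex without vertices has dimension `-1`, the dimension of its only face `∅`. -/
noncomputable def dim {V : Type*} (Γ : AbstractSimplicialComplex V) : ℤ :=
  ((sSup (Finset.card '' Γ.faces) : ℕ) : ℤ) - 1

/-- The 1-skeleton `Γ⁽¹⁾`, as a simple graph on the vertex set. -/
def oneSkeleton {V : Type*} [DecidableEq V] (Γ : AbstractSimplicialComplex V) :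
    SimpleGraph V where
  Adj u v := u ≠ v ∧ ({u, v} : Finset V) ∈ Γ.faces
  symm.symm u v h := ⟨h.1.symm, by rw [Finset.pair_comm]; exact h.2⟩
  loopless := ⟨fun _ h => h.1 rfl⟩

/-- `Γ_{V,F}`: the subcomplex with vertex set `V` whose faces are the faces of `Γ` all of whose
edges lie in `F`. -/
def edgeSubcomplex {V : Type*} (Γ : AbstractSimplicialComplex V) (F : Set (Sym2 V)) :
    AbstractSimplicialComplex V where
  faces := {X | X ∈ Γ.faces ∧ ∀ u ∈ X, ∀ v ∈ X, u ≠ v → s(u, v) ∈ F}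
  isRelLowerSet_faces := by
    rintro X ⟨hX, hF⟩
    refine ⟨(Γ.isRelLowerSet_faces hX).1, fun Y hYX hY => ?_⟩
    exact ⟨(Γ.isRelLowerSet_faces hX).2 hYX hY, fun u hu v hv => hF u (hYX hu) v (hYX hv)⟩
  singleton_mem v := by
    refine ⟨Γ.singleton_mem v, fun u hu w hw huw => ?_⟩
    rw [Finset.mem_singleton] at hu hw
    exact absurd (hu.trans hw.symm) huw

/-- An `s`-simplicial coloring: each face contains at most `s` vertices of any given color. -/
def IsSimplicialColoring {V C : Type*} [DecidableEq C] (Γ : AbstractSimplicialComplex V) (s : ℕ)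
    (f : V → C) : Prop :=
  ∀ X ∈ Γ.faces, ∀ i : C, (X.filter (fun v => f v = i)).card ≤ s

/-- The number of `s`-simplicial colorings with `t` colors. -/
noncomputable def numSimplicialColorings {V : Type*} (Γ : AbstractSimplicialComplex V)
    (s t : ℕ) : ℕ :=
  Nat.card {f : V → Fin t // Γ.IsSimplicialColoring s f}

/-- The number of `s`-simplicial colorings is a polynomial function of the number of colors. -/
theorem exists_polynomial_numSimplicialColorings {V : Type*} [Finite V]
    (Γ : AbstractSimplicialComplex V) (s : ℕ) :
    ∃ p : Polynomial ℤ, ∀ t : ℕ, p.eval (t : ℤ) = (Γ.numSimplicialColorings s t : ℤ) := by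
  classical
  have := Fintype.ofFinite V
  have : Finite (Setoid V) :=
    Finite.of_injective (fun r : Setoid V => r.r) (fun r r' h => Setoid.ext fun a b => by
      exact iff_of_eq (congrFun (congrFun h a) b))
  have := Fintype.ofFinite (Setoid V)
  let good : Setoid V → Prop := fun r => Γ.IsSimplicialColoring s (Quotient.mk r)
  refine ⟨∑ r : Setoid V, if good r then descPochhammer ℤ (Fintype.card (Quotient r)) else 0,
    fun t => ?_⟩
  have key : ∀ f : V → Fin t, Γ.IsSimplicialColoring s f ↔ good (Setoid.ker f) := by
    intro f
    constructor
    · intro h X hX i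
      induction i using Quotient.inductionOn with
      | h a =>
        refine le_trans (le_of_eq ?_) (h X hX (f a))
        congr 1
        ext v
        simp only [Finset.mem_filter]
        rw [Quotient.eq (r := Setoid.ker f)]
        rfl
    · intro h X hX i
      by_cases hi : ∃ a, f a = i
      · obtain ⟨a, rfl⟩ := hi
        refine le_trans (le_of_eq ?_) (h X hX (Quotient.mk (Setoid.ker f) a))
        congr 1
        ext v
        simp only [Finset.mem_filter]
        rw [Quotient.eq (r := Setoid.ker f)]
        rfl
      · rw [Finset.filter_false_of_mem fun v _ hv => hi ⟨v, hv⟩]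
        simp
  have fib : ∀ r : Setoid V,
      Fintype.card {f : V → Fin t // Setoid.ker f = r} =
        t.descFactorial (Fintype.card (Quotient r)) := by
    intro r
    have e : {f : V → Fin t // Setoid.ker f = r} ≃ (Quotient r ↪ Fin t) :=
      { toFun := fun f =>
          ⟨Quotient.lift f.1 (fun a b hab => by
              have : (Setoid.ker f.1) a b := by rw [f.2]; exact hab
              exact this), by
            intro a b
            induction a using Quotient.inductionOn
            induction b using Quotient.inductionOn
            rename_i a b
            intro hab
            apply Quotient.sound
            have h : (Setoid.ker f.1) a b := hab
            rw [f.2] at h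
            exact h⟩
        invFun := fun g => ⟨fun v => g (Quotient.mk r v), by
          ext a b
          rw [Setoid.ker_def, g.injective.eq_iff]
          exact Quotient.eq⟩
        left_inv := fun f => rfl
        right_inv := fun g => by
          ext a
          induction a using Quotient.inductionOn
          rfl }
    rw [Fintype.card_congr e, Fintype.card_embedding_eq, Fintype.card_fin]
  rw [numSimplicialColorings, Nat.card_eq_fintype_card, Fintype.card_subtype,
    Finset.card_eq_sum_card_fiberwise (f := fun f : V → Fin t => Setoid.ker f)
      (t := Finset.univ) (by simp)]
  rw [Polynomial.eval_finsetSum, Nat.cast_sum]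
  refine Finset.sum_congr rfl fun r _ => ?_
  rw [Finset.filter_filter]
  by_cases hr : good r
  · rw [if_pos hr, descPochhammer_eval_eq_descFactorial, ← fib r, Fintype.card_subtype]
    congr 2
    ext f
    simp only [Finset.mem_filter, Finset.mem_univ, true_and, key]
    constructor
    · rintro rfl
      exact ⟨hr, rfl⟩
    · exact fun h => h.2
  · rw [if_neg hr, Polynomial.eval_zero, Finset.filter_false_of_mem]
    · simp
    · rintro f - ⟨h, rfl⟩
      exact hr ((key f).1 h)

/-- The `s`-chromatic polynomial `χ_s(Γ; t)`: the polynomial whose value at each `t : ℕ` is the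
number of `s`-simplicial colorings of `Γ` with `t` colors. -/
noncomputable def sChromaticPolynomial {V : Type*} [Finite V] (Γ : AbstractSimplicialComplex V)
    (s : ℕ) : Polynomial ℤ :=
  (Γ.exists_polynomial_numSimplicialColorings s).choose

theorem sChromaticPolynomial_eval_natCast {V : Type*} [Finite V]
    (Γ : AbstractSimplicialComplex V) (s t : ℕ) :
    (Γ.sChromaticPolynomial s).eval (t : ℤ) = (Γ.numSimplicialColorings s t : ℤ) :=
  (Γ.exists_polynomial_numSimplicialColorings s).choose_spec t

/-- The defining property determines the `s`-chromatic polynomial, already on positive `t`. -/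
theorem eq_sChromaticPolynomial {V : Type*} [Finite V] (Γ : AbstractSimplicialComplex V) (s : ℕ)
    (p : Polynomial ℤ)
    (hp : ∀ t : ℕ, 1 ≤ t → p.eval (t : ℤ) = (Γ.numSimplicialColorings s t : ℤ)) :
    p = Γ.sChromaticPolynomial s := by
  refine Polynomial.eq_of_infinite_eval_eq _ _ (Set.Infinite.mono ?_
    (Set.infinite_range_of_injective (f := fun t : ℕ => ((t + 1 : ℕ) : ℤ))
      (fun a b h => by simpa using h)))
  rintro _ ⟨t, rfl⟩
  exact (hp (t + 1) (by omega)).trans (Γ.sChromaticPolynomial_eval_natCast s (t + 1)).symm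

end AbstractSimplicialComplex

/-!
Color the vertices of `Γ` by `f`. The edges of the 1-skeleton with both ends of the same color form
a flat `F`, and the colorings with a given `F` are the proper colorings of the contraction
`Γ⁽¹⁾ / F`. Whether `f` is `s`-simplicial depends on `F` alone: the faces of `Γ_{V,F}` are the
monochromatic faces of `Γ`. Hence `χ_s(Γ)` is the sum of the chromatic polynomials of the graphs
`Γ⁽¹⁾ / F` over the flats `F` with `dim Γ_{V,F} < s`, and Stanley's theorem
`χ_H(-1) = (-1)^|W| a(H)` evaluates each summand.

For Stanley's theorem, let `S` run over the independent sets of a graph `H` on `W ≠ ∅`. Removing the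
class `S` of the last color gives `χ_H(t) = ∑ χ_{H - S}(t - 1)`, so `∑ χ_{H - S}(-1) = χ_H(0) = 0`.
The numbers `(-1)^|W| a(H)` obey the same recursion: `a(H - S)` counts the acyclic orientations of
`H` in which all of `S` are sinks, and the sum of `(-1)^|S|` over the subsets `S` of the set of
sinks, which is nonempty, vanishes. As `S = ∅` contributes `H` itself, induction on `|W|` concludes.
-/

namespace ChromaticReciprocity

open SimpleGraph AbstractSimplicialComplex

theorem card_eq_sum_card_fiber {α β : Type*} [Finite α] (f : α → β) (s : Finset β)
    (hf : ∀ a, f a ∈ s) : Nat.card α = ∑ b ∈ s, Nat.card {a // f a = b} := by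
  classical
  have := Fintype.ofFinite α
  rw [Nat.card_eq_fintype_card, ← Finset.card_univ,
    Finset.card_eq_sum_card_fiberwise (f := f) (t := s) fun a _ => hf a]
  exact Finset.sum_congr rfl fun b _ => by rw [Nat.card_eq_fintype_card, Fintype.card_subtype]

/-- The independent sets of vertices of a finite graph. -/
noncomputable def indepFinsets {W : Type*} [Finite W] (H : SimpleGraph W) : Finset (Finset W) :=
  (Set.toFinite {S : Finset W | H.IsIndepSet (S : Set W)}).toFinset

theorem mem_indepFinsets {W : Type*} [Finite W] {H : SimpleGraph W} {S : Finset W} :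
    S ∈ indepFinsets H ↔ H.IsIndepSet (S : Set W) := by
  simp [indepFinsets]

section Coloring

variable {W W' : Type*} {H : SimpleGraph W} {H' : SimpleGraph W'} {α : Type*}

/-- Proper colorings in which `S` is the class of the extra color `none` correspond to proper
colorings of the rest of the graph by the other colors. -/
noncomputable def coloringOptionEquiv {S : Set W} (hS : H.IsIndepSet S) :
    {f : H.Coloring (Option α) // f.colorClass none = S} ≃ (H.induce Sᶜ).Coloring α where
  toFun f := Coloring.mk
    (fun w => (f.1 w).get (Option.isSome_iff_ne_none.2 fun h => w.2 (f.2.subset h)))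
    (fun {u v} huv h => f.1.valid (v := u) (w := v) huv (Option.get_inj.1 h))
  invFun g := by
    classical
    refine ⟨Coloring.mk (fun w => if h : w ∈ S then none else some (g ⟨w, h⟩)) ?_, ?_⟩
    · intro u v huv
      by_cases hu : u ∈ S <;> by_cases hv : v ∈ S
      · exact absurd huv (hS hu hv huv.ne)
      · simp [hu, hv]
      · simp [hu, hv]
      · simpa [hu, hv] using g.valid (v := ⟨u, hu⟩) (w := ⟨v, hv⟩) huv
    · ext w
      by_cases h : w ∈ S
      · exact iff_of_true (dif_pos h) h
      · exact iff_of_false (fun h' => Option.some_ne_none _ ((dif_neg h).symm.trans h')) h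
  left_inv f := by
    refine Subtype.ext (RelHom.ext fun w => ?_)
    by_cases h : w ∈ S
    · exact (dif_pos h).trans (f.2.superset h).symm
    · exact (dif_neg h).trans (Option.some_get _)
  right_inv g := by
    refine RelHom.ext fun w => Option.some_injective _ ?_
    exact (Option.some_get _).trans (dif_neg w.2)

theorem card_coloring_option [Finite W] [Finite α] (H : SimpleGraph W) :
    Nat.card (H.Coloring (Option α)) =
      ∑ S ∈ indepFinsets H, Nat.card ((H.induce (S : Set W)ᶜ).Coloring α) := by
  classical
  have := Fintype.ofFinite W
  have : Finite (H.Coloring (Option α)) := DFunLike.finite _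
  rw [card_eq_sum_card_fiber (fun f : H.Coloring (Option α) => (f.colorClass none).toFinset)
    (indepFinsets H) fun f => mem_indepFinsets.2 (by simpa using f.isIndepSet_colorClass none)]
  refine Finset.sum_congr rfl fun S hS => ?_
  rw [← Nat.card_congr (coloringOptionEquiv (mem_indepFinsets.1 hS))]
  simp only [← Finset.coe_inj, Set.coe_toFinset]

/-- Isomorphic graphs have the same proper colorings. -/
def coloringCongr (e : H ≃g H') : H.Coloring α ≃ H'.Coloring α where
  toFun f := f.comp e.symm.toHom
  invFun f := f.comp e.toHom
  left_inv f := RelHom.ext fun w => congrArg f (e.symm_apply_apply w)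
  right_inv f := RelHom.ext fun w => congrArg f (e.apply_symm_apply w)

/-- The clique complex of a graph. It turns proper colorings into simplicial colorings, so that
the chromatic polynomial of a graph becomes a special case of that of a complex. -/
def cliqueComplex (H : SimpleGraph W) : AbstractSimplicialComplex W where
  faces := {X | X.Nonempty ∧ H.IsClique X}
  isRelLowerSet_faces := fun _ hX =>
    ⟨hX.1, fun _ hYX hY => ⟨hY, hX.2.subset (Finset.coe_subset.2 hYX)⟩⟩
  singleton_mem v := ⟨Finset.singleton_nonempty v, by simp⟩

theorem isSimplicialColoring_cliqueComplex_one [DecidableEq α] (f : W → α) :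
    (cliqueComplex H).IsSimplicialColoring 1 f ↔ ∀ u v, H.Adj u v → f u ≠ f v := by
  classical
  constructor
  · intro h u v huv hf
    have hX : {u, v} ∈ (cliqueComplex H).faces :=
      ⟨Finset.insert_nonempty _ _, by simpa using isClique_pair.2 fun _ => huv⟩
    exact huv.ne (Finset.card_le_one.1 (h _ hX (f v)) u (by simp [hf]) v (by simp))
  · rintro h X ⟨-, hX⟩ i
    refine Finset.card_le_one.2 fun u hu v hv => ?_
    rw [Finset.mem_filter] at hu hv
    by_contra huv
    exact h u v (hX hu.1 hv.1 huv) (hu.2.trans hv.2.symm)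

theorem numSimplicialColorings_cliqueComplex_one (H : SimpleGraph W) (t : ℕ) :
    (cliqueComplex H).numSimplicialColorings 1 t = Nat.card (H.Coloring (Fin t)) :=
  Nat.card_congr
    { toFun f := Coloring.mk f.1 fun {u v} => (isSimplicialColoring_cliqueComplex_one f.1).1 f.2 u v
      invFun g := ⟨g, (isSimplicialColoring_cliqueComplex_one g).2 fun _ _ => g.valid⟩ }

end Coloring

section ChromaticPolynomial

variable {W W' : Type*} [Finite W] [Finite W'] {H : SimpleGraph W} {H' : SimpleGraph W'}

/-- The chromatic polynomial of a graph, obtained as the `1`-chromatic polynomial of the clique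
complex. -/
noncomputable def chromaticPolynomial (H : SimpleGraph W) : Polynomial ℤ :=
  (cliqueComplex H).sChromaticPolynomial 1

theorem chromaticPolynomial_eval_natCast (H : SimpleGraph W) (t : ℕ) :
    (chromaticPolynomial H).eval (t : ℤ) = Nat.card (H.Coloring (Fin t)) := by
  rw [chromaticPolynomial, sChromaticPolynomial_eval_natCast,
    numSimplicialColorings_cliqueComplex_one]

theorem eq_chromaticPolynomial {p : Polynomial ℤ}
    (hp : ∀ t : ℕ, 1 ≤ t → p.eval (t : ℤ) = Nat.card (H.Coloring (Fin t))) :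
    p = chromaticPolynomial H :=
  eq_sChromaticPolynomial _ _ _ fun t ht => by
    rw [hp t ht, numSimplicialColorings_cliqueComplex_one]

theorem chromaticPolynomial_congr (e : H ≃g H') :
    chromaticPolynomial H = chromaticPolynomial H' :=
  eq_chromaticPolynomial fun t _ => by
    rw [chromaticPolynomial_eval_natCast, Nat.card_congr (coloringCongr e)]

theorem chromaticPolynomial_of_isEmpty [IsEmpty W] (H : SimpleGraph W) :
    chromaticPolynomial H = 1 := by
  refine (eq_chromaticPolynomial fun t _ => ?_).symm
  have : Unique (H.Coloring (Fin t)) :=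
    { default := .ofIsEmpty, uniq := fun f => RelHom.ext isEmptyElim }
  simp

theorem chromaticPolynomial_eval_zero [Nonempty W] (H : SimpleGraph W) :
    (chromaticPolynomial H).eval 0 = 0 := by
  have : IsEmpty (H.Coloring (Fin 0)) := ⟨fun f => (f (Classical.arbitrary W)).elim0⟩
  simpa using chromaticPolynomial_eval_natCast H 0

theorem chromaticPolynomial_eq_sum_comp (H : SimpleGraph W) :
    chromaticPolynomial H =
      ∑ S ∈ indepFinsets H,
        (chromaticPolynomial (H.induce (S : Set W)ᶜ)).comp (Polynomial.X - 1) := by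
  refine (eq_chromaticPolynomial fun t ht => ?_).symm
  obtain ⟨t, rfl⟩ := Nat.exists_eq_add_of_le' ht
  rw [Nat.card_congr (H.recolorOfEquiv (finSuccEquiv t)), card_coloring_option]
  simp [Polynomial.eval_finsetSum, chromaticPolynomial_eval_natCast]

theorem sum_chromaticPolynomial_induce_compl_eval_neg_one [Nonempty W] (H : SimpleGraph W) :
    ∑ S ∈ indepFinsets H,
      (chromaticPolynomial (H.induce (S : Set W)ᶜ)).eval (-1) = 0 := by
  rw [← chromaticPolynomial_eval_zero H, chromaticPolynomial_eq_sum_comp H]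
  simp [Polynomial.eval_finsetSum]

end ChromaticPolynomial

section AcyclicOrientation

variable {W W' : Type*} {H : SimpleGraph W} {H' : SimpleGraph W'} {D : Digraph W} {S : Set W}

/-- An acyclic orientation of `H`, as counted by `SimpleGraph.numAcyclicOrientations`. -/
def IsAcyclicOrientation (H : SimpleGraph W) (D : Digraph W) : Prop :=
  H.IsOrientation D ∧ ∀ v, ¬ Relation.TransGen D.Adj v v

/-- The sinks of a digraph. -/
def sinks (D : Digraph W) : Set W := {v | ∀ w, ¬ D.Adj v w}

/-- The pullback of a digraph along a map of vertices. -/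
def digraphComap (f : W' → W) (D : Digraph W) : Digraph W' where
  Adj u v := D.Adj (f u) (f v)

theorem IsAcyclicOrientation.comap (hD : IsAcyclicOrientation H D) (f : H' ↪g H) :
    IsAcyclicOrientation H' (digraphComap f D) :=
  ⟨⟨fun _ _ h => f.map_adj_iff.1 (hD.1.1 _ _ h), fun _ _ h => hD.1.2 _ _ (f.map_adj_iff.2 h)⟩,
    fun v h => hD.2 (f v) (h.lift f fun _ _ => id)⟩

theorem numAcyclicOrientations_congr (e : H ≃g H') :
    H.numAcyclicOrientations = H'.numAcyclicOrientations :=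
  Nat.card_congr
    { toFun D := ⟨_, IsAcyclicOrientation.comap D.2 e.symm.toEmbedding⟩
      invFun D := ⟨_, IsAcyclicOrientation.comap D.2 e.toEmbedding⟩
      left_inv D := by ext; simp [digraphComap]
      right_inv D := by ext; simp [digraphComap] }

theorem numAcyclicOrientations_of_isEmpty [IsEmpty W] (H : SimpleGraph W) :
    H.numAcyclicOrientations = 1 := by
  rw [SimpleGraph.numAcyclicOrientations, Nat.card_eq_one_iff_unique]
  exact ⟨inferInstance, ⟨⟨⊥, ⟨isEmptyElim, isEmptyElim⟩, isEmptyElim⟩⟩⟩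

theorem isIndepSet_sinks (hD : H.IsOrientation D) : H.IsIndepSet (sinks D) :=
  fun u hu v hv _ huv => (hD.2 u v huv).elim (fun h => hu v h.1) (fun h => hv u h.1)

theorem IsAcyclicOrientation.sinks_nonempty [Finite W] [Nonempty W]
    (hD : IsAcyclicOrientation H D) : (sinks D).Nonempty := by
  let r : W → W → Prop := fun u v => Relation.TransGen D.Adj v u
  have : IsTrans W r := ⟨fun _ _ _ h h' => h'.trans h⟩
  have : Std.Irrefl r := ⟨hD.2⟩
  obtain ⟨v, -, hv⟩ := (Finite.wellFounded_of_trans_of_irrefl r).has_min Set.univ Set.univ_nonempty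
  exact ⟨v, fun w h => hv w trivial (.single h)⟩

/-- The digraph extending the digraph `D` on the complement of `S` by all edges of `H` that go from
that complement into `S`. It inverts restriction to the complement of `S` for orientations of `H` in
which all of `S` are sinks. -/
def extendBySinks (H : SimpleGraph W) (S : Set W) (D : Digraph ↥Sᶜ) : Digraph W where
  Adj u v := u ∉ S ∧ v ∈ S ∧ H.Adj u v ∨ ∃ hu hv, D.Adj ⟨u, hu⟩ ⟨v, hv⟩

theorem subset_sinks_extendBySinks (H : SimpleGraph W) (S : Set W) (D : Digraph ↥Sᶜ) :
    S ⊆ sinks (extendBySinks H S D) := by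
  rintro v hv w (h | ⟨h, _⟩)
  · exact h.1 hv
  · exact h hv

theorem extendBySinks_adj_coe {D : Digraph ↥Sᶜ} {u v : ↥Sᶜ} :
    (extendBySinks H S D).Adj u v ↔ D.Adj u v :=
  ⟨fun h => h.elim (fun h => absurd h.2.1 v.2) fun ⟨_, _, h⟩ => h, fun h => .inr ⟨u.2, v.2, h⟩⟩

theorem digraphComap_extendBySinks (D : Digraph ↥Sᶜ) :
    digraphComap Subtype.val (extendBySinks H S D) = D := by
  ext u v
  exact extendBySinks_adj_coe

theorem extendBySinks_digraphComap (hD : H.IsOrientation D) (hS : S ⊆ sinks D) :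
    extendBySinks H S (digraphComap Subtype.val D) = D := by
  ext u v
  constructor
  · rintro (⟨-, hv, huv⟩ | ⟨_, _, h⟩)
    · exact (hD.2 u v huv).elim And.left fun h => absurd h.1 (hS hv u)
    · exact h
  · intro h
    have hu : u ∉ S := fun hu => hS hu v h
    by_cases hv : v ∈ S
    · exact .inl ⟨hu, hv, hD.1 u v h⟩
    · exact .inr ⟨hu, hv, h⟩

theorem isOrientation_extendBySinks (hS : H.IsIndepSet S) {D : Digraph ↥Sᶜ}
    (hD : (H.induce Sᶜ).IsOrientation D) : H.IsOrientation (extendBySinks H S D) := by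
  refine ⟨?_, fun u v huv => ?_⟩
  · rintro u v (h | ⟨_, _, h⟩)
    · exact h.2.2
    · exact hD.1 _ _ h
  · have hsink := subset_sinks_extendBySinks H S D
    by_cases hu : u ∈ S <;> by_cases hv : v ∈ S
    · exact absurd huv (hS hu hv huv.ne)
    · exact .inr ⟨.inl ⟨hv, hu, huv.symm⟩, hsink hu v⟩
    · exact .inl ⟨.inl ⟨hu, hv, huv⟩, hsink hv u⟩
    · have := hD.2 ⟨u, hu⟩ ⟨v, hv⟩ huv
      rwa [← extendBySinks_adj_coe (H := H), ← extendBySinks_adj_coe (H := H)] at this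

theorem transGen_of_transGen_extendBySinks {D : Digraph ↥Sᶜ} {u v : W}
    (h : Relation.TransGen (extendBySinks H S D).Adj u v) (hv : v ∉ S) :
    ∃ hu, Relation.TransGen D.Adj ⟨u, hu⟩ ⟨v, hv⟩ := by
  induction h using Relation.TransGen.head_induction_on with
  | single h =>
    rcases h with h | ⟨hu, _, h⟩
    · exact absurd h.2.1 hv
    · exact ⟨hu, .single h⟩
  | head h _ ih =>
    obtain ⟨hc, ih⟩ := ih
    rcases h with h | ⟨hu, _, h⟩
    · exact absurd h.2.1 hc
    · exact ⟨hu, .head h ih⟩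

theorem IsAcyclicOrientation.extendBySinks (hS : H.IsIndepSet S) {D : Digraph ↥Sᶜ}
    (hD : IsAcyclicOrientation (H.induce Sᶜ) D) :
    IsAcyclicOrientation H (extendBySinks H S D) := by
  refine ⟨isOrientation_extendBySinks hS hD.1, fun v hcycle => ?_⟩
  have hv : v ∉ S := fun hv =>
    let ⟨w, hvw, _⟩ := Relation.TransGen.head'_iff.1 hcycle
    subset_sinks_extendBySinks H S D hv w hvw
  exact hD.2 _ (transGen_of_transGen_extendBySinks hcycle hv).2

/-- Acyclic orientations of `H` in which every vertex of the independent set `S` is a sink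
correspond to acyclic orientations of the graph induced on the complement of `S`. -/
def acyclicOrientationSinksEquiv (hS : H.IsIndepSet S) :
    {D : Digraph W // IsAcyclicOrientation H D ∧ S ⊆ sinks D} ≃
      {D : Digraph ↥Sᶜ // IsAcyclicOrientation (H.induce Sᶜ) D} where
  toFun D := ⟨_, D.2.1.comap (Embedding.induce Sᶜ)⟩
  invFun D := ⟨extendBySinks H S D, D.2.extendBySinks hS, subset_sinks_extendBySinks H S D⟩
  left_inv D := Subtype.ext (extendBySinks_digraphComap D.2.1.1 D.2.2)
  right_inv D := Subtype.ext (digraphComap_extendBySinks D.1)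

theorem sum_neg_one_pow_mul_numAcyclicOrientations_induce_compl [Finite W] [Nonempty W]
    (H : SimpleGraph W) :
    ∑ S ∈ indepFinsets H,
      (-1 : ℤ) ^ S.card * (H.induce (S : Set W)ᶜ).numAcyclicOrientations = 0 := by
  classical
  have := Fintype.ofFinite W
  have hcard (S : Finset W) (hS : S ∈ indepFinsets H) :
      (H.induce (S : Set W)ᶜ).numAcyclicOrientations =
        Finset.card {D : Digraph W | IsAcyclicOrientation H D ∧ (S : Set W) ⊆ sinks D} := by
    rw [← Fintype.card_subtype, ← Nat.card_eq_fintype_card]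
    exact (Nat.card_congr (acyclicOrientationSinksEquiv (mem_indepFinsets.1 hS))).symm
  calc
    _ = ∑ S ∈ indepFinsets H,
          ∑ D : Digraph W with IsAcyclicOrientation H D ∧ (S : Set W) ⊆ sinks D,
            (-1 : ℤ) ^ S.card := by
      refine Finset.sum_congr rfl fun S hS => ?_
      rw [hcard S hS, Finset.sum_const, nsmul_eq_mul, mul_comm]
    _ = ∑ D : Digraph W with IsAcyclicOrientation H D,
          ∑ S ∈ (sinks D).toFinset.powerset, (-1 : ℤ) ^ S.card := by
      refine Finset.sum_comm' fun S D => ?_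
      simp only [mem_indepFinsets, Finset.mem_filter, Finset.mem_univ, true_and,
        Finset.mem_powerset, Set.subset_toFinset]
      exact ⟨fun h => ⟨h.2.2, h.2.1⟩, fun h => ⟨(isIndepSet_sinks h.2.1).mono h.1, h.2, h.1⟩⟩
    _ = 0 := Finset.sum_eq_zero fun D hD =>
      Finset.sum_powerset_neg_one_pow_card_of_nonempty
        (Set.toFinset_nonempty.2 (Finset.mem_filter.1 hD).2.sinks_nonempty)

end AcyclicOrientation

theorem card_add_card_coe_compl {W : Type*} [Finite W] (S : Finset W) :
    S.card + Nat.card ↥(S : Set W)ᶜ = Nat.card W := by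
  rw [← Set.ncard_coe_finset, Nat.card_coe_set_eq, Set.ncard_add_ncard_compl]

theorem sum_chromaticPolynomial_sub_numAcyclicOrientations {W : Type*} [Finite W] [Nonempty W]
    (H : SimpleGraph W) :
    ∑ S ∈ indepFinsets H,
      ((chromaticPolynomial (H.induce (S : Set W)ᶜ)).eval (-1) -
        (-1) ^ Nat.card ↥(S : Set W)ᶜ * (H.induce (S : Set W)ᶜ).numAcyclicOrientations) = 0 := by
  have hsign (S : Finset W) :
      (-1 : ℤ) ^ Nat.card ↥(S : Set W)ᶜ = (-1) ^ Nat.card W * (-1) ^ S.card := by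
    rw [← card_add_card_coe_compl S, pow_add, mul_right_comm, ← pow_add, ← two_mul]
    simp
  simp only [hsign, mul_assoc, Finset.sum_sub_distrib, ← Finset.mul_sum,
    sum_chromaticPolynomial_induce_compl_eval_neg_one,
    sum_neg_one_pow_mul_numAcyclicOrientations_induce_compl, mul_zero, sub_zero]

/-- **Stanley's theorem** on acyclic orientations. -/
theorem chromaticPolynomial_eval_neg_one {W : Type*} [Finite W] (H : SimpleGraph W) :
    (chromaticPolynomial H).eval (-1) = (-1) ^ Nat.card W * H.numAcyclicOrientations := by
  induction hn : Nat.card W using Nat.strong_induction_on generalizing W with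
  | _ n ih =>
    subst hn
    cases isEmpty_or_nonempty W
    · simp [chromaticPolynomial_of_isEmpty, numAcyclicOrientations_of_isEmpty]
    have hsum := sum_chromaticPolynomial_sub_numAcyclicOrientations H
    rw [Finset.sum_eq_single_of_mem ∅ (mem_indepFinsets.2 (by simp))] at hsum
    · have e : H.induce ((∅ : Finset W) : Set W)ᶜ ≃g H := by
        rw [Finset.coe_empty, Set.compl_empty]
        exact induceUnivIso H
      rwa [chromaticPolynomial_congr e, numAcyclicOrientations_congr e, Nat.card_congr e.toEquiv,
        sub_eq_zero] at hsum
    · intro S _ hS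
      have hpos : 0 < S.card := Finset.card_pos.2 (Finset.nonempty_iff_ne_empty.2 hS)
      have hlt : Nat.card ↥(S : Set W)ᶜ < Nat.card W := by
        have := card_add_card_coe_compl S
        omega
      rw [ih _ hlt (H.induce (S : Set W)ᶜ) rfl, sub_self]

section Flat

variable {V α : Type*} {G : SimpleGraph V} {F : Set (Sym2 V)} {f : V → α} {u v : V}

/-- The edges of `G` whose two ends have the same color. -/
def monochromaticEdges (G : SimpleGraph V) (f : V → α) : Set (Sym2 V) :=
  G.edgeSet ∩ {e | (e.map f).IsDiag}

theorem mk_mem_monochromaticEdges : s(u, v) ∈ monochromaticEdges G f ↔ G.Adj u v ∧ f u = f v := by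
  simp [monochromaticEdges]

theorem eq_of_reachable_monochromaticEdges
    (h : (fromEdgeSet (monochromaticEdges G f)).Reachable u v) : f u = f v := by
  obtain ⟨p⟩ := h
  induction p with
  | nil => rfl
  | cons h _ ih => exact (mk_mem_monochromaticEdges.1 h.1).2.trans ih

theorem isFlat_monochromaticEdges (G : SimpleGraph V) (f : V → α) :
    G.IsFlat (monochromaticEdges G f) := by
  refine ⟨Set.inter_subset_left, fun C => ?_⟩
  ext ⟨u, hu⟩ ⟨v, hv⟩
  have huv : f u = f v :=
    eq_of_reachable_monochromaticEdges (ConnectedComponent.exact (hu.trans hv.symm))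
  rw [comap_adj, comap_adj]
  exact ⟨fun h => h.1.1, fun h => ⟨mk_mem_monochromaticEdges.2 ⟨h, huv⟩, h.ne⟩⟩

theorem mk_mem_iff_of_isFlat (hF : G.IsFlat F) :
    s(u, v) ∈ F ↔ G.Adj u v ∧ (fromEdgeSet F).connectedComponentMk u =
      (fromEdgeSet F).connectedComponentMk v := by
  constructor
  · intro h
    have huv : G.Adj u v := hF.1 h
    exact ⟨huv, ConnectedComponent.sound (Adj.reachable ⟨h, huv.ne⟩)⟩
  · rintro ⟨huv, h⟩
    have hadj : ((fromEdgeSet F).induce ((fromEdgeSet F).connectedComponentMk v).supp).Adj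
        ⟨u, h⟩ ⟨v, rfl⟩ := by
      rw [hF.2 ((fromEdgeSet F).connectedComponentMk v)]
      exact huv
    exact hadj.1

/-- Colorings whose set of monochromatic edges is the flat `F` correspond to proper colorings of
the contraction of `F`. -/
def coloringContractEdgesEquiv (hF : G.IsFlat F) :
    {f : V → α // monochromaticEdges G f = F} ≃ (G.contractEdges F).Coloring α where
  toFun f := Coloring.mk
    (ConnectedComponent.lift f.1 fun u v p _ =>
      eq_of_reachable_monochromaticEdges (G := G) (by rw [f.2]; exact ⟨p⟩)) (by
    rintro _ _ ⟨hne, u, v, huv, rfl, rfl⟩ h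
    have huvF : s(u, v) ∈ F := f.2.subset (mk_mem_monochromaticEdges.2 ⟨huv, h⟩)
    exact hne ((mk_mem_iff_of_isFlat hF).1 huvF).2)
  invFun g := ⟨fun v => g ((fromEdgeSet F).connectedComponentMk v), by
    ext ⟨u, v⟩
    refine mk_mem_monochromaticEdges.trans (Iff.trans ?_ (mk_mem_iff_of_isFlat hF).symm)
    refine and_congr_right fun huv => ⟨fun h => ?_, congrArg g⟩
    by_contra hne
    exact g.valid (map_adj_apply' huv hne) h⟩
  left_inv f := rfl
  right_inv g := RelHom.ext (ConnectedComponent.ind fun _ => rfl)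

end Flat

section SimplicialColoring

variable {V α : Type*} {Γ : AbstractSimplicialComplex V} {X : Finset V} {f : V → α} {u v : V}

theorem dim_lt_iff [Finite V] {s : ℕ} : Γ.dim < (s : ℤ) ↔ ∀ X ∈ Γ.faces, X.card ≤ s := by
  have hbdd : BddAbove (Finset.card '' Γ.faces) := (Set.toFinite _).bddAbove
  rw [dim, sub_lt_iff_lt_add, Int.lt_add_one_iff, Nat.cast_le, csSup_le_iff' hbdd,
    Set.forall_mem_image]

theorem isSimplicialColoring_iff_forall_monochromatic [DecidableEq α] {s : ℕ} :
    Γ.IsSimplicialColoring s f ↔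
      ∀ X ∈ Γ.faces, (∀ u ∈ X, ∀ v ∈ X, f u = f v) → X.card ≤ s := by
  constructor
  · intro h X hX hmono
    obtain ⟨a, ha⟩ := (Γ.isRelLowerSet_faces hX).1
    simpa [Finset.filter_true_of_mem fun v hv => hmono v hv a ha] using h X hX (f a)
  · intro h X hX i
    rcases (X.filter fun v => f v = i).eq_empty_or_nonempty with hempty | hne
    · simp [hempty]
    · refine h _ ((Γ.isRelLowerSet_faces hX).2 (Finset.filter_subset _ X) hne) fun u hu v hv => ?_
      exact (Finset.mem_filter.1 hu).2.trans (Finset.mem_filter.1 hv).2.symm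

variable [DecidableEq V]

theorem oneSkeleton_adj_of_mem_faces (hX : X ∈ Γ.faces) (hu : u ∈ X) (hv : v ∈ X) (huv : u ≠ v) :
    Γ.oneSkeleton.Adj u v :=
  ⟨huv, (Γ.isRelLowerSet_faces hX).2 (Finset.insert_subset hu (Finset.singleton_subset_iff.2 hv))
    (Finset.insert_nonempty _ _)⟩

theorem mem_faces_edgeSubcomplex_monochromaticEdges :
    X ∈ (Γ.edgeSubcomplex (monochromaticEdges Γ.oneSkeleton f)).faces ↔
      X ∈ Γ.faces ∧ ∀ u ∈ X, ∀ v ∈ X, f u = f v := by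
  refine and_congr_right fun hX => forall₄_congr fun u hu v hv => ⟨fun h => ?_, fun h huv => ?_⟩
  · by_cases huv : u = v
    · rw [huv]
    · exact (mk_mem_monochromaticEdges.1 (h huv)).2
  · exact mk_mem_monochromaticEdges.2 ⟨oneSkeleton_adj_of_mem_faces hX hu hv huv, h⟩

theorem isSimplicialColoring_iff_dim_lt [Finite V] [DecidableEq α] {s : ℕ} :
    Γ.IsSimplicialColoring s f ↔
      (Γ.edgeSubcomplex (monochromaticEdges Γ.oneSkeleton f)).dim < (s : ℤ) := by
  simp only [isSimplicialColoring_iff_forall_monochromatic, dim_lt_iff,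
    mem_faces_edgeSubcomplex_monochromaticEdges, and_imp]

theorem numSimplicialColorings_eq_sum [Finite V] (Γ : AbstractSimplicialComplex V) (s t : ℕ) :
    Γ.numSimplicialColorings s t =
      ∑ F ∈ Γ.oneSkeleton.flats with (Γ.edgeSubcomplex F).dim < (s : ℤ),
        Nat.card ((Γ.oneSkeleton.contractEdges F).Coloring (Fin t)) := by
  rw [numSimplicialColorings, card_eq_sum_card_fiber
    (fun f : {f : V → Fin t // Γ.IsSimplicialColoring s f} =>
      monochromaticEdges Γ.oneSkeleton f.1) _ fun f => ?_]
  · refine Finset.sum_congr rfl fun F hF => ?_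
    simp only [flats, Finset.mem_filter, Set.Finite.mem_toFinset, Set.mem_ofPred_eq] at hF
    obtain ⟨hflat, hdim⟩ := hF
    rw [← Nat.card_congr (coloringContractEdgesEquiv hflat)]
    refine Nat.card_congr (Equiv.subtypeSubtypeEquivSubtype
      (p := fun f : V → Fin t => Γ.IsSimplicialColoring s f)
      (q := fun f => monochromaticEdges Γ.oneSkeleton f = F) fun hf => ?_)
    rwa [isSimplicialColoring_iff_dim_lt, hf]
  · simpa [flats, isFlat_monochromaticEdges] using isSimplicialColoring_iff_dim_lt.1 f.2

theorem sChromaticPolynomial_eq_sum [Finite V] (Γ : AbstractSimplicialComplex V) (s : ℕ) :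
    Γ.sChromaticPolynomial s =
      ∑ F ∈ Γ.oneSkeleton.flats with (Γ.edgeSubcomplex F).dim < (s : ℤ),
        chromaticPolynomial (Γ.oneSkeleton.contractEdges F) := by
  refine (Γ.eq_sChromaticPolynomial s _ fun t _ => ?_).symm
  rw [Polynomial.eval_finsetSum, numSimplicialColorings_eq_sum, Nat.cast_sum]
  exact Finset.sum_congr rfl fun F _ => chromaticPolynomial_eval_natCast _ t

end SimplicialColoring

end ChromaticReciprocity

theorem mainTheorem2 {V : Type*} [Finite V] [DecidableEq V]
    (Γ : AbstractSimplicialComplex V) (s : ℕ) (hs : 1 ≤ s) :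
    (Γ.sChromaticPolynomial s).eval (-1) =
      ∑ F ∈ Γ.oneSkeleton.flats with (Γ.edgeSubcomplex F).dim < (s : ℤ),
        (-1 : ℤ) ^ SimpleGraph.numComponents F *
          ((Γ.oneSkeleton.contractEdges F).numAcyclicOrientations : ℤ) := by
  rw [ChromaticReciprocity.sChromaticPolynomial_eq_sum, Polynomial.eval_finsetSum]
  exact Finset.sum_congr rfl fun F _ => ChromaticReciprocity.chromaticPolynomial_eval_neg_one _
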